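/- For topological spaces $X$ and $Y$, let $B_0(X,Y)$ be the set of continuous functions $X\to Y$; for $0<\alpha<\omega_1$ let $B_\alpha(X,Y)$ be the set of pointwise limits of sequences of functions from $\bigcup_{\beta<\alpha}B_\beta(X,Y)$; and put $B(X,Y)=\bigcup_{\alpha<\omega_1}B_\alpha(X,Y)$. Let $B_1^{st}(X,Y)$ be the set of all $f:X\to Y$ for which there is a sequence $(f_n)_{n\in\omega}$ of continuous functions $X\to Y$ such that $\{n\in\omega: f_n(x)\neq f(x)\}$ is finite for every $x\in X$. The space $X$ is called $Y$-Tychonoff if for every closed $A\subseteq X$, every $y_0\in Y$, every finite $F\subseteq X\setminus A$ and every function $f:F\to Y$ there is a continuous $\bar f:X\to Y$ with $\bar f|_F=f$ and $\bar f(A)\subseteq\{y_0\}$. **Theorem.** Let $Y$ be a metrizable space containing at least two points, let $K$ be a $Y$-Tychonoff compact space, and let $H$ be a set of functions with $B_1^{st}(K,Y)\subseteq H\subseteq B(K,Y)$, endowed with the topology of pointwise convergence (that is, the subspace topology inherited from the product $Y^K$). Then the following assertions are equivalent: (i) $H$ is a Fréchet–Urysohn space; (ii) $H$ is a sequential space;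 (iii) $H$ has countable tightness, i.e. whenever $h\in H$ lies in the closure of a set $A\subseteq H$, it lies in the closure of a countable subset of $A$; (iv) $K$ is scattered, i.e. every nonempty subset of $K$ has a point that is isolated in that subset. -/

import Mathlib

open Set Filter Topology

/-- `X` is `Y`-Tychonoff: every function from a finite set disjoint from a closed set `A` extends to
a continuous function `X → Y` that takes a prescribed value on all of `A`. -/
def IsTychonoffFor (X Y : Type*) [TopologicalSpace X] [TopologicalSpace Y] : Prop :=
  ∀ (A : Set X), IsClosed A → ∀ (y₀ : Y) (F : Set X), F.Finite → F ⊆ Aᶜ → ∀ f : F → Y,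
    ∃ g : X → Y, Continuous g ∧ (∀ x : F, g x = f x) ∧ ∀ x ∈ A, g x = y₀

/-- The Baire class `B_α(X, Y)`: the continuous functions for `α = 0`; for `α ≠ 0`, the pointwise
limits of sequences of functions, each belonging to some `B_β(X, Y)` with `β < α`.
(The neighbourhood filter of `X → Y` is that of the product topology.) -/
def BaireClass (X Y : Type*) [TopologicalSpace X] [TopologicalSpace Y] (α : Ordinal.{0}) :
    Set (X → Y) :=
  {f | (α = 0 ∧ Continuous f) ∨
    (α ≠ 0 ∧ ∃ u : ℕ → X → Y,
      (∀ n, ∃ β : Ordinal.{0}, ∃ _ : β < α, u n ∈ BaireClass X Y β) ∧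
        Tendsto u atTop (𝓝 f))}
termination_by α

/-- The set `B(X, Y)` of all Baire functions: the union of the classes `B_α(X, Y)`, `α < ω₁`. -/
def BaireFunctions (X Y : Type*) [TopologicalSpace X] [TopologicalSpace Y] : Set (X → Y) :=
  ⋃ α ∈ Set.Iio (Ordinal.omega 1 : Ordinal.{0}), BaireClass X Y α

/-- A sequence of functions converges stably to `f` if at each point all but finitely many of its
terms agree with `f`. -/
def StablyConverges {X Y : Type*} (u : ℕ → X → Y) (f : X → Y) : Prop :=
  ∀ x, {n | u n x ≠ f x}.Finite

/-- The stable Baire-one class: limits of stably convergent sequences of continuous functions. -/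
def StableBaireOne (X Y : Type*) [TopologicalSpace X] [TopologicalSpace Y] : Set (X → Y) :=
  {f | ∃ u : ℕ → X → Y, (∀ n, Continuous (u n)) ∧ StablyConverges u f}

/-- Countable tightness: each point in the closure of a set is in the closure of a countable
subset of that set. -/
def HasCountableTightness (X : Type*) [TopologicalSpace X] : Prop :=
  ∀ (A : Set X) (x : X), x ∈ closure A → ∃ B ⊆ A, B.Countable ∧ x ∈ closure B

/-- A space is scattered if each nonempty subset has a point isolated in that subset. -/
def IsScatteredSpace (X : Type*) [TopologicalSpace X] : Prop :=
  ∀ S : Set X, S.Nonempty → ∃ x ∈ S, ∃ U : Set X, IsOpen U ∧ U ∩ S = {x}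

/-! The bridge is `HasCountableGδSubcovers`, which for compact Hausdorff spaces is equivalent to
scatteredness. A Baire function is constant on a `Gδ` neighbourhood of each point. If `K` is
scattered, so are its finite powers; countable subcovers there shrink `A` to a countable set that
still approximates `f` on every finite set, and one on `K` reduces pointwise convergence to a
countable set of points. Conversely, countable tightness applied to stable Baire-one indicators
indexed by finite sets yields countable subcovers, while a non-scattered compact space carries a
Cantor scheme with too many branches for such a subcover. -/

/-- Every assignment of a `Gδ` neighbourhood to each point has a countable subcover; that is, the
topology generated by the `Gδ` sets is Lindelöf. -/
def HasCountableGδSubcovers (X : Type*) [TopologicalSpace X] : Prop :=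
  ∀ W : X → Set X, (∀ x, IsGδ (W x)) → (∀ x, x ∈ W x) →
    ∃ T : Set X, T.Countable ∧ ∀ z, ∃ x ∈ T, z ∈ W x

/-! ### Hausdorffness and permanence of scatteredness -/

theorem IsTychonoffFor.t2Space {X Y : Type*} [TopologicalSpace X] [TopologicalSpace Y] [T2Space Y]
    [Nontrivial Y] (h : IsTychonoffFor X Y) : T2Space X := by
  classical
  refine ⟨fun x y hxy => ?_⟩
  obtain ⟨a, b, hab⟩ := exists_pair_ne Y
  obtain ⟨g, hg, hgf, -⟩ := h ∅ isClosed_empty a {x, y} (Set.toFinite _) (by simp)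
    (fun z => if (z : X) = x then a else b)
  have hx : g x = a := by simpa using hgf ⟨x, by simp⟩
  have hy : g y = b := by simpa [hxy.symm] using hgf ⟨y, by simp⟩
  exact separated_by_continuous hg (by rwa [hx, hy])

theorem IsScatteredSpace.of_injective {X Z : Type*} [TopologicalSpace X] [TopologicalSpace Z]
    (h : IsScatteredSpace Z) {g : X → Z} (hg : Continuous g) (hinj : Function.Injective g) :
    IsScatteredSpace X := by
  intro S hS
  obtain ⟨_, ⟨x, hx, rfl⟩, U, hU, hUS⟩ := h (g '' S) (hS.image g)
  refine ⟨x, hx, g ⁻¹' U, hU.preimage hg, ?_⟩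
  ext z
  constructor
  · rintro ⟨hz, hzS⟩
    have : g z ∈ U ∩ g '' S := ⟨hz, z, hzS, rfl⟩
    rw [hUS] at this
    exact hinj this
  · rintro rfl
    have : g z ∈ U ∩ g '' S := by rw [hUS]; rfl
    exact ⟨this.1, hx⟩

theorem IsScatteredSpace.prod {X Z : Type*} [TopologicalSpace X] [TopologicalSpace Z]
    (hX : IsScatteredSpace X) (hZ : IsScatteredSpace Z) : IsScatteredSpace (X × Z) := by
  intro S hS
  obtain ⟨_, ⟨⟨x, z₀⟩, hx, rfl⟩, U, hU, hUS⟩ := hX (Prod.fst '' S) (hS.image _)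
  obtain ⟨z, hz, V, hV, hVS⟩ := hZ {z | (x, z) ∈ S} ⟨z₀, hx⟩
  refine ⟨(x, z), hz, U ×ˢ V, hU.prod hV, ?_⟩
  ext ⟨a, b⟩
  constructor
  · rintro ⟨⟨ha, hb⟩, hab⟩
    have h₁ : a ∈ U ∩ Prod.fst '' S := ⟨ha, _, hab, rfl⟩
    rw [hUS] at h₁
    obtain rfl : a = x := h₁
    have h₂ : b ∈ V ∩ {z | (a, z) ∈ S} := ⟨hb, hab⟩
    rw [hVS] at h₂
    obtain rfl : b = z := h₂
    rfl
  · intro h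
    obtain ⟨rfl, rfl⟩ := Prod.mk.inj (Set.mem_singleton_iff.1 h)
    have h₁ : a ∈ U ∩ Prod.fst '' S := by rw [hUS]; rfl
    have h₂ : b ∈ V ∩ {z | (a, z) ∈ S} := by rw [hVS]; rfl
    exact ⟨⟨h₁.1, h₂.1⟩, hz⟩

theorem IsScatteredSpace.finPow {X : Type*} [TopologicalSpace X] (hX : IsScatteredSpace X) (n : ℕ) :
    IsScatteredSpace (Fin n → X) := by
  induction n with
  | zero =>
    rintro S ⟨x, hx⟩
    exact ⟨x, hx, univ, isOpen_univ, by ext y; simp [Subsingleton.elim y x, hx]⟩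
  | succ n ih =>
    refine (hX.prod ih).of_injective (g := fun x => (x 0, Fin.tail x)) ?_ ?_
    · exact (continuous_apply 0).prodMk (continuous_pi fun i => continuous_apply _)
    · intro x y hxy
      obtain ⟨h₀, h₁⟩ := Prod.mk.inj hxy
      rw [← Fin.cons_self_tail x, ← Fin.cons_self_tail y, h₀, h₁]

/-! ### Scatteredness versus countable `Gδ` subcovers -/

theorem IsScatteredSpace.hasCountableGδSubcovers {X : Type*} [TopologicalSpace X] [CompactSpace X]
    [T2Space X] (hX : IsScatteredSpace X) : HasCountableGδSubcovers X := by
  intro W hW hxW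
  let Good : Set X → Prop := fun C => ∃ T : Set X, T.Countable ∧ C ⊆ ⋃ x ∈ T, W x
  have good_mono : ∀ {C D}, C ⊆ D → Good D → Good C := fun h ⟨T, hT, hD⟩ => ⟨T, hT, h.trans hD⟩
  have good_iUnion : ∀ C : ℕ → Set X, (∀ n, Good (C n)) → Good (⋃ n, C n) := by
    intro C h
    choose T hT hC using h
    exact ⟨⋃ n, T n, countable_iUnion hT, iUnion_subset fun n => (hC n).trans <|
      biUnion_subset_biUnion_left (subset_iUnion T n)⟩
  have good_union : ∀ {C D}, Good C → Good D → Good (C ∪ D) := by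
    rintro C D ⟨T, hT, hC⟩ ⟨T', hT', hD⟩
    exact ⟨T ∪ T', hT.union hT', by rw [biUnion_union]; exact union_subset_union hC hD⟩
  have good_compact : ∀ C, IsCompact C → (∀ x ∈ C, ∃ U ∈ 𝓝 x, Good U) → Good C := by
    intro C hC h
    refine hC.induction_on ⟨∅, countable_empty, empty_subset _⟩ (fun _ _ => good_mono)
      (fun _ _ => good_union) fun x hx => ?_
    obtain ⟨U, hU, hg⟩ := h x hx
    exact ⟨U, mem_nhdsWithin_of_mem_nhds hU, hg⟩
  -- An isolated point `x` of the set of bad points has a compact neighbourhood `V` with no other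
  -- bad point. Each `V \ O n` is compact and omits `x`, hence is good, and `W x` covers the rest of
  -- `V`.
  have local_good : ∀ x, ∃ U ∈ 𝓝 x, Good U := by
    by_contra! hbad
    obtain ⟨x, hx, U, hU, hUS⟩ := hX {x | ∀ U ∈ 𝓝 x, ¬ Good U} hbad
    have hxU : x ∈ U := by
      have : x ∈ U ∩ {x | ∀ U ∈ 𝓝 x, ¬ Good U} := by rw [hUS]; rfl
      exact this.1
    obtain ⟨V, hV, hVU, hVc⟩ := local_compact_nhds (hU.mem_nhds hxU)
    refine hx V hV ?_
    obtain ⟨O, hO, hOW⟩ := isGδ_iff_eq_iInter_nat.1 (hW x)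
    have hdiff : ∀ n, Good (V \ O n) := fun n => by
      refine good_compact _ (hVc.diff (hO n)) fun z hz => ?_
      by_contra! hzbad
      have : z ∈ U ∩ {x | ∀ U ∈ 𝓝 x, ¬ Good U} := ⟨hVU hz.1, hzbad⟩
      rw [hUS] at this
      obtain rfl : z = x := this
      have hzW := hxW z
      rw [hOW] at hzW
      exact hz.2 (mem_iInter.1 hzW n)
    refine good_mono ?_ (good_union (D := W x) (good_iUnion _ hdiff)
      ⟨{x}, countable_singleton x, by simp⟩)
    intro z hz
    by_cases hzW : z ∈ W x
    · exact Or.inr hzW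
    · rw [hOW, mem_iInter, not_forall] at hzW
      obtain ⟨n, hn⟩ := hzW
      exact Or.inl (mem_iUnion.2 ⟨n, hz, hn⟩)
  obtain ⟨T, hT, hcov⟩ := good_compact univ isCompact_univ fun x _ => local_good x
  exact ⟨T, hT, fun z => by simpa using hcov (mem_univ z)⟩

/-- Two disjoint open sets, with closures inside `U`, around two points of `S ∩ U`. -/
theorem exists_open_pair_of_not_isolated {X : Type*} [TopologicalSpace X] [T2Space X]
    [RegularSpace X] {S : Set X} (hS : ∀ x ∈ S, ∀ U : Set X, IsOpen U → U ∩ S ≠ {x}) (U : Set X)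
    (hU : IsOpen U) (hUS : (U ∩ S).Nonempty) :
    ∃ V : Bool → Set X, (∀ b, IsOpen (V b) ∧ (V b ∩ S).Nonempty ∧ closure (V b) ⊆ U) ∧
      Disjoint (V false) (V true) := by
  obtain ⟨x, hxU, hxS⟩ := hUS
  obtain ⟨y, ⟨hyU, hyS⟩, hyx⟩ : ∃ y ∈ U ∩ S, y ≠ x := by
    by_contra! h
    exact hS x hxS U hU (Subset.antisymm h (by rintro _ rfl; exact ⟨hxU, hxS⟩))
  obtain ⟨A, B, hA, hB, hxA, hyB, hAB⟩ := t2_separation hyx.symm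
  have key : ∀ z ∈ U, ∀ O, IsOpen O → z ∈ O → ∃ V, IsOpen V ∧ z ∈ V ∧ closure V ⊆ U ∧ V ⊆ O := by
    intro z hz O hO hzO
    obtain ⟨C, hC, hCc, hCU⟩ := exists_mem_nhds_isClosed_subset ((hU.inter hO).mem_nhds ⟨hz, hzO⟩)
    exact ⟨interior C, isOpen_interior, mem_interior_iff_mem_nhds.2 hC,
      (closure_minimal interior_subset hCc).trans (hCU.trans inter_subset_left),
      interior_subset.trans (hCU.trans inter_subset_right)⟩
  obtain ⟨V, hV, hxV, hVU, hVA⟩ := key x hxU A hA hxA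
  obtain ⟨V', hV', hyV', hVU', hVB⟩ := key y hyU B hB hyB
  refine ⟨fun b => cond b V' V, ?_, hAB.mono hVA hVB⟩
  rintro (_ | _)
  · exact ⟨hV, ⟨x, hxV, hxS⟩, hVU⟩
  · exact ⟨hV', ⟨y, hyV', hyS⟩, hVU'⟩

theorem HasCountableGδSubcovers.isScatteredSpace {X : Type*} [TopologicalSpace X] [CompactSpace X]
    [T2Space X] (hX : HasCountableGδSubcovers X) : IsScatteredSpace X := by
  classical
  intro S hSne
  by_contra! hS
  choose V hV hdisj using exists_open_pair_of_not_isolated hS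
  let Node := {U : Set X // IsOpen U ∧ (U ∩ S).Nonempty}
  let child : Node → Bool → Node := fun U b =>
    ⟨V U.1 U.2.1 U.2.2 b, (hV U.1 U.2.1 U.2.2 b).1, (hV U.1 U.2.1 U.2.2 b).2.1⟩
  -- The newest letter is the head of the list, as in `PiNat.res`.
  let tree : List Bool → Node := fun l =>
    l.foldr (fun b U => child U b) ⟨univ, isOpen_univ, by simpa using hSne⟩
  let U : List Bool → Set X := fun l => (tree l).1
  have U_open : ∀ l, IsOpen (U l) := fun l => (tree l).2.1
  have U_ne : ∀ l, (U l).Nonempty := fun l => (tree l).2.2.mono inter_subset_left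
  have U_closure : ∀ l b, closure (U (b :: l)) ⊆ U l := fun l b =>
    (hV (tree l).1 (tree l).2.1 (tree l).2.2 b).2.2
  have U_disj : ∀ l b c, b ≠ c → Disjoint (U (b :: l)) (U (c :: l)) := by
    intro l b c hbc
    have h := hdisj (tree l).1 (tree l).2.1 (tree l).2.2
    cases b <;> cases c
    · exact absurd rfl hbc
    · exact h
    · exact h.symm
    · exact absurd rfl hbc
  have U_mem_eq : ∀ (x : X) (β γ : ℕ → Bool), (∀ n, x ∈ U (PiNat.res β n)) →
      (∀ n, x ∈ U (PiNat.res γ n)) → β = γ := by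
    intro x β γ hβ hγ
    apply PiNat.res_injective
    funext n
    induction n with
    | zero => rfl
    | succ n ih =>
      have h₁ := hβ (n + 1)
      have h₂ := hγ (n + 1)
      rw [PiNat.res_succ] at h₁ h₂ ⊢
      rw [PiNat.res_succ, ← ih] at *
      by_contra hne
      exact disjoint_left.1 (U_disj _ (β n) (γ n) fun h => hne (by rw [h])) h₁ h₂
  have branch : ∀ β : ℕ → Bool, ∃ x, ∀ n, x ∈ U (PiNat.res β n) := by
    intro β
    obtain ⟨x, hx⟩ := IsCompact.nonempty_iInter_of_sequence_nonempty_isCompact_isClosed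
      (fun n => closure (U (PiNat.res β n)))
      (fun n => by rw [PiNat.res_succ]; exact (U_closure _ _).trans subset_closure)
      (fun n => (U_ne _).closure) isClosed_closure.isCompact fun n => isClosed_closure
    refine ⟨x, fun n => U_closure _ (β n) ?_⟩
    rw [← PiNat.res_succ]
    exact mem_iInter.1 hx (n + 1)
  choose p hp using branch
  -- If `x` lies outside the node `l`, then `W x` misses the closures of both children of `l`. So `W
  -- x` can contain `p β` only if `x` lies on the whole branch `β`, and disjointness of siblings
  -- lets `x` determine `β`.
  let W : X → Set X := fun x =>
    ⋂ q : List Bool × Bool, if x ∈ U q.1 then U q.1 else (closure (U (q.2 :: q.1)))ᶜ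
  obtain ⟨T, hT, hcov⟩ := hX W
    (fun x => IsGδ.iInter_of_isOpen fun q => by
      split_ifs
      · exact U_open _
      · exact isClosed_closure.isOpen_compl)
    (fun x => mem_iInter.2 fun q => by
      split_ifs with h
      · exact h
      · exact fun h' => h (U_closure _ _ h'))
  have mem_of_branch : ∀ x β, p β ∈ W x → ∀ n, x ∈ U (PiNat.res β n) := by
    intro x β h n
    by_contra hx
    have h' := mem_iInter.1 h (PiNat.res β n, β n)
    simp only [hx, if_false] at h'
    rw [← PiNat.res_succ] at h'
    exact h' (subset_closure (hp β (n + 1)))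
  choose t htT ht using fun β => hcov (p β)
  have : Countable T := hT
  have hinj : Function.Injective fun β => (⟨t β, htT β⟩ : T) := by
    intro β γ h
    have h' : t β = t γ := congrArg Subtype.val h
    refine U_mem_eq (t β) β γ (mem_of_branch _ _ (ht β)) ?_
    rw [h']
    exact mem_of_branch _ _ (ht γ)
  have hle := Cardinal.mk_le_aleph0_iff.2 hinj.countable
  simp only [Cardinal.mk_pi, Cardinal.mk_bool, Cardinal.prod_const', Cardinal.mk_nat] at hle
  exact hle.not_gt (Cardinal.cantor _)

/-! ### Baire functions and the Fréchet–Urysohn property -/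

theorem exists_isGδ_subset_fiber_of_mem_baireClass {X Y : Type*} [TopologicalSpace X]
    [TopologicalSpace Y] [TopologicalSpace.MetrizableSpace Y] (α : Ordinal.{0}) :
    ∀ f ∈ BaireClass X Y α, ∀ x, ∃ G, IsGδ G ∧ x ∈ G ∧ ∀ z ∈ G, f z = f x := by
  let := TopologicalSpace.metrizableSpaceMetric Y
  induction α using WellFoundedLT.induction with
  | ind α ih =>
    intro f hf x
    rw [BaireClass] at hf
    rcases hf with ⟨-, hf⟩ | ⟨-, u, hu, hlim⟩
    · exact ⟨f ⁻¹' {f x}, (IsGδ.singleton _).preimage hf, rfl, fun z hz => hz⟩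
    · have : ∀ n, ∃ G, IsGδ G ∧ x ∈ G ∧ ∀ z ∈ G, u n z = u n x := fun n => by
        obtain ⟨β, hβ, hn⟩ := hu n
        exact ih β hβ _ hn x
      choose G hG hxG hGu using this
      refine ⟨⋂ n, G n, .iInter hG, mem_iInter.2 hxG, fun z hz => ?_⟩
      rw [tendsto_pi_nhds] at hlim
      refine tendsto_nhds_unique (hlim z) ((hlim x).congr fun n => ?_)
      exact (hGu n z (mem_iInter.1 hz n)).symm

theorem BaireFunctions.exists_isGδ_subset_fiber {X Y : Type*} [TopologicalSpace X]
    [TopologicalSpace Y] [TopologicalSpace.MetrizableSpace Y] {f : X → Y}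
    (hf : f ∈ BaireFunctions X Y) (x : X) : ∃ G, IsGδ G ∧ x ∈ G ∧ ∀ z ∈ G, f z = f x := by
  simp only [BaireFunctions, mem_iUnion] at hf
  obtain ⟨α, -, hα⟩ := hf
  exact exists_isGδ_subset_fiber_of_mem_baireClass α f hα x

theorem IsScatteredSpace.frechetUrysohnSpace {K Y : Type*} [TopologicalSpace K] [CompactSpace K]
    [T2Space K] [TopologicalSpace Y] [TopologicalSpace.MetrizableSpace Y] (hK : IsScatteredSpace K)
    {H : Set (K → Y)} (hH : H ⊆ BaireFunctions K Y) : FrechetUrysohnSpace H := by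
  let := TopologicalSpace.metrizableSpaceMetric Y
  refine ⟨fun A f hf => ?_⟩
  -- The set `D` below must be nonempty to be enumerated by `ℕ`.
  rcases isEmpty_or_nonempty K with hKe | hKne
  · obtain ⟨a, ha⟩ := closure_nonempty_iff.1 ⟨f, hf⟩
    exact subset_seqClosure (Subsingleton.elim a f ▸ ha)
  choose G hG hxG hGf using fun (h : H) (x : K) =>
    BaireFunctions.exists_isGδ_subset_fiber (hH h.2) x
  have approx : ∀ (n : ℕ) (x : Fin n → K), ∃ a ∈ A, ∀ i,
      dist (a.1 (x i)) (f.1 (x i)) < 1 / ((n : ℝ) + 1) := by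
    intro n x
    have hev : ∀ᶠ a : H in 𝓝 f, ∀ i, dist (a.1 (x i)) (f.1 (x i)) < 1 / ((n : ℝ) + 1) := by
      refine eventually_all.2 fun i => ?_
      have hc : Continuous fun a : H => dist (a.1 (x i)) (f.1 (x i)) :=
        ((continuous_apply (x i)).comp continuous_subtype_val).dist continuous_const
      refine hc.continuousAt.eventually_lt_const ?_
      simp only [dist_self]
      positivity
    obtain ⟨a, ha, haA⟩ := mem_closure_iff_nhds.1 hf _ hev
    exact ⟨a, haA, ha⟩
  choose a haA ha using approx
  -- On the chosen box around `x`, both `f` and `a n x` keep their values at `x`, so the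
  -- approximation at `x` transfers to every tuple in the box.
  have cover : ∀ n, ∃ T : Set (Fin n → K), T.Countable ∧
      ∀ z : Fin n → K, ∃ x ∈ T, ∀ i, z i ∈ G f (x i) ∩ G (a n x) (x i) := by
    intro n
    obtain ⟨T, hT, h⟩ := (hK.finPow n).hasCountableGδSubcovers
      (fun x => ⋂ i, (fun z => z i) ⁻¹' (G f (x i) ∩ G (a n x) (x i)))
      (fun x => .iInter fun i => ((hG _ _).inter (hG _ _)).preimage (continuous_apply i))
      (fun x => mem_iInter.2 fun i => ⟨hxG _ _, hxG _ _⟩)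
    exact ⟨T, hT, fun z => by simpa using h z⟩
  choose T hT hcov using cover
  let B : Set H := ⋃ n, a n '' T n
  have hBc : B.Countable := countable_iUnion fun n => (hT n).image _
  have hBA : B ⊆ A := by
    rintro _ hb
    obtain ⟨n, x, -, rfl⟩ := mem_iUnion.1 hb
    exact haA n x
  have hB : ∀ (n : ℕ) (z : Fin n → K), ∃ b ∈ B, ∀ i,
      dist (b.1 (z i)) (f.1 (z i)) < 1 / ((n : ℝ) + 1) := by
    intro n z
    obtain ⟨x, hx, hz⟩ := hcov n z
    refine ⟨a n x, mem_iUnion.2 ⟨n, x, hx, rfl⟩, fun i => ?_⟩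
    rw [hGf _ _ _ (hz i).1, hGf _ _ _ (hz i).2]
    exact ha n x i
  have : Countable B := hBc
  -- Every point agrees with some point of `D` under `f` and all of `B` at once, so convergence on
  -- `D` suffices; `b n` is controlled at the first `n` points of `D`.
  obtain ⟨D, hD, hDcov⟩ := hK.hasCountableGδSubcovers (fun x => G f x ∩ ⋂ b : B, G b x)
    (fun x => (hG _ _).inter (.iInter fun b => hG _ _))
    (fun x => ⟨hxG _ _, mem_iInter.2 fun b => hxG _ _⟩)
  obtain ⟨d, rfl⟩ := hD.exists_eq_range ((hDcov (Classical.arbitrary K)).imp fun _ h => h.1)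
  choose b hbB hb using fun n : ℕ => hB n fun i => d i
  refine ⟨b, fun n => hBA (hbB n), tendsto_subtype_rng.2 (tendsto_pi_nhds.2 fun z => ?_)⟩
  obtain ⟨_, ⟨m, rfl⟩, hzf, hzB⟩ := hDcov z
  rw [hGf _ _ _ hzf, tendsto_iff_dist_tendsto_zero]
  refine squeeze_zero' (.of_forall fun _ => dist_nonneg) ?_ tendsto_one_div_add_atTop_nhds_zero_nat
  filter_upwards [eventually_gt_atTop m] with n hn
  rw [hGf _ _ _ (mem_iInter.1 hzB ⟨b n, hbB n⟩)]
  exact (hb n ⟨m, hn⟩).le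

/-! ### Countable tightness and the covers it yields -/

theorem hasCountableTightness_of_sequentialSpace (X : Type*) [TopologicalSpace X]
    [SequentialSpace X] : HasCountableTightness X := by
  intro A x hx
  let C : Set X := {x | ∃ B ⊆ A, B.Countable ∧ x ∈ closure B}
  have hC : IsSeqClosed C := by
    intro u p hu hup
    choose B hBA hB huB using hu
    exact ⟨⋃ n, B n, iUnion_subset hBA, countable_iUnion hB, isClosed_closure.mem_of_tendsto hup
      (.of_forall fun n => closure_mono (subset_iUnion B n) (huB n))⟩
  have hAC : A ⊆ C := fun a ha =>
    ⟨{a}, singleton_subset_iff.2 ha, countable_singleton a, subset_closure rfl⟩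
  exact closure_minimal hAC hC.isClosed hx

/-- A finite set inside a `Gδ` set can be enlarged, within that set, to a set whose two-valued
indicator functions are stable limits of continuous functions. -/
theorem IsTychonoffFor.exists_indicator_mem_stableBaireOne {X Y : Type*} [TopologicalSpace X]
    [TopologicalSpace Y] [TopologicalSpace.MetrizableSpace Y] (h : IsTychonoffFor X Y)
    {y₀ y₁ : Y} (hy : y₀ ≠ y₁) {F : Set X} (hF : F.Finite) {V : Set X} (hV : IsGδ V) (hFV : F ⊆ V) :
    ∃ f ∈ StableBaireOne X Y, (∀ x ∈ F, f x = y₁) ∧ ∀ x ∉ V, f x = y₀ := by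
  classical
  let := TopologicalSpace.metrizableSpaceMetric Y
  obtain ⟨O, hO, hOV⟩ := isGδ_iff_eq_iInter_nat.1 hV
  -- The state records the largest distance from `y₁` that earlier functions reached at each point.
  -- The next function must be `y₀` wherever this is at least `1 / (n + 1)`; hence one departure
  -- from `y₁` at a point forces the value `y₀` there eventually.
  let State := {D : X → ℝ // Continuous D ∧ ∀ x ∈ F, D x = 0}
  have step : ∀ (n : ℕ) (D : State), ∃ g : X → Y, Continuous g ∧ (∀ x ∈ F, g x = y₁) ∧
      ∀ x, (1 / ((n : ℝ) + 1) ≤ D.1 x ∨ ∃ i ≤ n, x ∉ O i) → g x = y₀ := by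
    rintro n ⟨D, hD, hDF⟩
    have hclosed : IsClosed ({x | 1 / ((n : ℝ) + 1) ≤ D x} ∪ ⋃ i ∈ Iic n, (O i)ᶜ) :=
      (isClosed_le continuous_const hD).union
        ((finite_Iic n).isClosed_biUnion fun i _ => (hO i).isClosed_compl)
    have hdisj : F ⊆ ({x | 1 / ((n : ℝ) + 1) ≤ D x} ∪ ⋃ i ∈ Iic n, (O i)ᶜ)ᶜ := by
      rintro x hx (hx' | hx')
      · have : 1 / ((n : ℝ) + 1) ≤ 0 := hDF x hx ▸ hx'
        exact absurd this (not_le.2 (by positivity))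
      · obtain ⟨i, -, hi⟩ := mem_iUnion₂.1 hx'
        have hxV := hFV hx
        rw [hOV] at hxV
        exact hi (mem_iInter.1 hxV i)
    obtain ⟨g, hg, hgF, hgA⟩ := h _ hclosed y₀ F hF hdisj fun _ => y₁
    refine ⟨g, hg, fun x hx => hgF ⟨x, hx⟩, fun x hx => hgA x ?_⟩
    rcases hx with hx | ⟨i, hi, hx⟩
    · exact Or.inl hx
    · exact Or.inr (mem_biUnion (mem_Iic.2 hi) hx)
  choose g hg hgF hgA using step
  let D : ℕ → State := fun n => Nat.rec ⟨fun _ => 0, continuous_const, fun _ _ => rfl⟩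
    (fun n D => ⟨fun x => max (D.1 x) (dist (g n D x) y₁),
      D.2.1.max ((hg n D).dist continuous_const),
      fun x hx => by simp [D.2.2 x hx, hgF n D x hx]⟩) n
  have D_succ : ∀ n x, (D (n + 1)).1 x = max ((D n).1 x) (dist (g n (D n) x) y₁) := fun n x => rfl
  have D_mono : ∀ x, Monotone fun n => (D n).1 x := fun x =>
    monotone_nat_of_le_succ fun n => by rw [D_succ]; exact le_max_left _ _
  have eventually_eq : ∀ x i, g i (D i) x ≠ y₁ → ∀ᶠ n in atTop, g n (D n) x = y₀ := by
    intro x i hi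
    have hpos : 0 < dist (g i (D i) x) y₁ := dist_pos.2 hi
    filter_upwards [eventually_ge_atTop (i + 1),
      (tendsto_one_div_add_atTop_nhds_zero_nat (𝕜 := ℝ)).eventually_lt_const hpos] with n hn hlt
    refine hgA n (D n) x (Or.inl (hlt.le.trans (le_trans ?_ (D_mono x hn))))
    exact (le_max_right _ _).trans (D_succ i x).ge
  refine ⟨fun x => if ∀ n, g n (D n) x = y₁ then y₁ else y₀,
    ⟨fun n => g n (D n), fun n => hg n _, fun x => ?_⟩, fun x hx => ?_, fun x hx => ?_⟩
  · suffices ∀ᶠ n in cofinite, g n (D n) x = if ∀ n, g n (D n) x = y₁ then y₁ else y₀ from this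
    rw [Nat.cofinite_eq_atTop]
    by_cases hx : ∀ n, g n (D n) x = y₁
    · simp [hx]
    · simp only [hx, if_false]
      obtain ⟨i, hi⟩ := not_forall.1 hx
      exact eventually_eq x i hi
  · exact if_pos fun n => hgF n _ x hx
  · refine if_neg fun hall => ?_
    rw [hOV, mem_iInter, not_forall] at hx
    obtain ⟨i, hi⟩ := hx
    exact hy ((hgA i (D i) x (Or.inr ⟨i, le_rfl, hi⟩)).symm.trans (hall i))

/-- Indicators squeezed between a finite `F` and `⋃ x ∈ F, W x` converge along `F` to the constant
`y₁`. If countably many of them have this constant in their closure, each `z` has one with value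
other than `y₀` at `z`, so `z` is covered by the corresponding finite union. -/
theorem IsTychonoffFor.hasCountableGδSubcovers {X Y : Type*} [TopologicalSpace X]
    [TopologicalSpace Y] [TopologicalSpace.MetrizableSpace Y] [Nontrivial Y]
    (h : IsTychonoffFor X Y) {H : Set (X → Y)} (hH : StableBaireOne X Y ⊆ H)
    (ht : HasCountableTightness H) : HasCountableGδSubcovers X := by
  let := TopologicalSpace.metrizableSpaceMetric Y
  intro W hW hxW
  obtain ⟨y₀, y₁, hy⟩ := exists_pair_ne Y
  choose f hf hfF hfV using fun F : Finset X =>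
    h.exists_indicator_mem_stableBaireOne hy F.finite_toSet (V := ⋃ x ∈ F, W x)
      (.biUnion F.finite_toSet fun x _ => hW x)
      (fun x hx => mem_biUnion (Finset.mem_coe.2 hx) (hxW x))
  let φ : Finset X → H := fun F => ⟨f F, hH (hf F)⟩
  let c : H := ⟨fun _ => y₁, hH ⟨fun _ _ => y₁, fun _ => continuous_const, fun x => by simp⟩⟩
  have hc : Tendsto φ atTop (𝓝 c) := by
    refine tendsto_subtype_rng.2 (tendsto_pi_nhds.2 fun x => ?_)
    refine tendsto_const_nhds.congr' ?_
    filter_upwards [eventually_ge_atTop {x}] with F hF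
    exact (hfF F x (hF (Finset.mem_singleton_self x))).symm
  obtain ⟨B, hB, hBc, hcB⟩ := ht (range φ) c
    (mem_closure_of_tendsto hc (.of_forall fun F => mem_range_self F))
  choose F hF using fun b : B => hB b.2
  have : Countable B := hBc
  refine ⟨⋃ b : B, F b, countable_iUnion fun b => (F b).countable_toSet, fun z => ?_⟩
  have hopen : IsOpen {b : H | b.1 z ≠ y₀} :=
    isOpen_ne.preimage ((continuous_apply z).comp continuous_subtype_val)
  obtain ⟨b, hbz, hbB⟩ := mem_closure_iff.1 hcB _ hopen hy.symm
  have hz : z ∈ ⋃ x ∈ F ⟨b, hbB⟩, W x := by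
    by_contra hz
    exact hbz ((congrArg (fun a : H => a.1 z) (hF ⟨b, hbB⟩)).symm.trans (hfV _ z hz))
  obtain ⟨x, hx, hzx⟩ := mem_iUnion₂.1 hz
  exact ⟨x, mem_iUnion.2 ⟨⟨b, hbB⟩, hx⟩, hzx⟩

theorem theoremt {K Y : Type*} [TopologicalSpace K] [CompactSpace K] [TopologicalSpace Y]
    [TopologicalSpace.MetrizableSpace Y] [Nontrivial Y] (hK : IsTychonoffFor K Y)
    (H : Set (K → Y)) (hH₁ : StableBaireOne K Y ⊆ H) (hH₂ : H ⊆ BaireFunctions K Y) :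
    [FrechetUrysohnSpace H, SequentialSpace H, HasCountableTightness H,
      IsScatteredSpace K].TFAE := by
  have : T2Space K := hK.t2Space
  tfae_have 1 → 2 := fun _ => inferInstance
  tfae_have 2 → 3 := fun _ => hasCountableTightness_of_sequentialSpace H
  tfae_have 3 → 4 := fun h => (hK.hasCountableGδSubcovers hH₁ h).isScatteredSpace
  tfae_have 4 → 1 := fun h => h.frechetUrysohnSpace hH₂
  tfae_finish
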